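/- For a positive integer $n$ let $\mathbb{M}_n$ be the algebra of complex $n\times n$ matrices, and let $\le$ denote the Loewner order ($X\le Y$ if and only if $Y-X$ is positive semidefinite). A pair $(A,B)$ of matrices in $\mathbb{M}_n$ is called a monotone pair if there exist a positive semidefinite $C\in\mathbb{M}_n$ and two non-negative, non-decreasing functions $f,g$ on $[0,\infty)$ (not necessarily continuous) such that $A=f(C)$ and $B=g(C)$. Let $(A,B)$ be a monotone pair in $\mathbb{M}_n$ and let $\Phi:\mathbb{M}_n\to\mathbb{M}_d$ be a positive linear map (it maps positive semidefinite matrices to positive semidefinite matrices) that is sub-unital, i.e. $\Phi(I)\le I$. Then, for some unitary $V\in\mathbb{M}_d$, $$\Phi(A)\,\Phi(B)\,\Phi(A)\le V\,\Phi(ABA)\,V^*.$$ -/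

import Mathlib

open scoped ComplexOrder MatrixOrder

/-- `(A, B)` is a monotone pair in `M_n(ℂ)`: there are a positive semidefinite `C` and two
non-negative, non-decreasing functions `f`, `g` on `[0, ∞)` with `A = f(C)` and `B = g(C)`.
No continuity of `f` and `g` is required: the spectrum of `C` is a finite subset of `[0, ∞)`, so
`cfc` is the usual spectral functional calculus for every function. -/
def IsMonotonePair {n : ℕ} (A B : Matrix (Fin n) (Fin n) ℂ) : Prop :=
  ∃ (C : Matrix (Fin n) (Fin n) ℂ) (f g : ℝ → ℝ),
    C.PosSemidef ∧
    (∀ t : ℝ, 0 ≤ t → 0 ≤ f t) ∧ MonotoneOn f (Set.Ici 0) ∧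
    (∀ t : ℝ, 0 ≤ t → 0 ≤ g t) ∧ MonotoneOn g (Set.Ici 0) ∧
    A = cfc f C ∧ B = cfc g C

/-- A positive linear map `Φ : M_n(ℂ) → M_d(ℂ)` is sub-unital if `Φ(I) ≤ I` in the Loewner
order. -/
def IsSubUnital {n d : ℕ}
    (Φ : Matrix (Fin n) (Fin n) ℂ →ₚ[ℂ] Matrix (Fin d) (Fin d) ℂ) : Prop :=
  Φ 1 ≤ 1

/-! Let `P i ≥ 0` be the images under `Φ` of the rank-one eigenprojections of `C`, so `∑ P i ≤ 1`.
With X = ∑ aᵢPᵢ, Y = ∑ bᵢPᵢ and R = ∑ aᵢ²bᵢPᵢ it is enough to compare the i-th eigenvalues μ of XYX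
and λ of R. A dimension count gives g ≠ 0 with μ‖g‖² ≤ ⟨Yh,h⟩ and ⟨Rh,h⟩ ≤ λ‖h‖², where h = Xg. For
μ > 0, Cauchy–Schwarz, Kadison and Chebyshev, in that order, yield μ‖h‖⁴ ≤ μ‖g‖²‖Xh‖² ≤ ⟨Yh,h⟩ ∑
aᵢ²⟨Pᵢh,h⟩ ≤ ⟨Rh,h⟩ ∑ ⟨Pᵢh,h⟩ ≤ λ‖h‖⁴. Monotonicity enters only through Chebyshev. -/

open Matrix in
/-- The real part of the quadratic form of a complex matrix. -/
noncomputable def quadForm {d : ℕ} (M : Matrix (Fin d) (Fin d) ℂ) (x : Fin d → ℂ) : ℝ :=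
  (star x ⬝ᵥ (M *ᵥ x)).re

section QuadForm

open Matrix

variable {d : ℕ}

lemma quadForm_nonneg {M : Matrix (Fin d) (Fin d) ℂ} (hM : 0 ≤ M) (x : Fin d → ℂ) :
    0 ≤ quadForm M x :=
  (Complex.le_def.1 ((nonneg_iff_posSemidef.1 hM).dotProduct_mulVec_nonneg x)).1

lemma quadForm_mono {M N : Matrix (Fin d) (Fin d) ℂ} (h : M ≤ N) (x : Fin d → ℂ) :
    quadForm M x ≤ quadForm N x := by
  have := quadForm_nonneg (sub_nonneg.2 h) x
  simpa [quadForm, sub_mulVec] using this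

lemma quadForm_sum_smul {ι : Type*} (s : Finset ι) (a : ι → ℝ)
    (P : ι → Matrix (Fin d) (Fin d) ℂ) (x : Fin d → ℂ) :
    quadForm (∑ i ∈ s, (a i : ℂ) • P i) x = ∑ i ∈ s, a i * quadForm (P i) x := by
  simp [quadForm, sum_mulVec, dotProduct_sum, smul_mulVec]

lemma quadForm_one (x : Fin d → ℂ) : quadForm 1 x = ∑ i, ‖x i‖ ^ 2 := by
  simp [quadForm, dotProduct, ← Complex.normSq_eq_conj_mul_self, Complex.normSq_eq_norm_sq,
    -Complex.mul_re]
  norm_cast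

lemma quadForm_one_pos {x : Fin d → ℂ} (hx : x ≠ 0) : 0 < quadForm 1 x := by
  obtain ⟨i, hi⟩ := Function.ne_iff.1 hx
  rw [quadForm_one]
  exact Finset.sum_pos' (fun j _ => by positivity) ⟨i, Finset.mem_univ i, by
    have : 0 < ‖x i‖ := norm_pos_iff.2 hi
    positivity⟩

lemma quadForm_mul_mul {X : Matrix (Fin d) (Fin d) ℂ} (M : Matrix (Fin d) (Fin d) ℂ)
    (x : Fin d → ℂ) : quadForm (Xᴴ * M * X) x = quadForm M (X *ᵥ x) := by
  simp [quadForm, star_mulVec, ← mulVec_mulVec, dotProduct_mulVec, vecMul_vecMul, Matrix.mul_assoc]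

lemma quadForm_smul_sub {P : Matrix (Fin d) (Fin d) ℂ} (hP : P.IsHermitian) (a : ℝ)
    (x y : Fin d → ℂ) :
    quadForm P ((a : ℂ) • x - y) =
      a ^ 2 * quadForm P x - 2 * (a * (star y ⬝ᵥ (P *ᵥ x)).re) + quadForm P y := by
  have h : (star x ⬝ᵥ (P *ᵥ y)).re = (star y ⬝ᵥ (P *ᵥ x)).re := by
    have : star x ⬝ᵥ (P *ᵥ y) = star (star y ⬝ᵥ (P *ᵥ x)) := by
      rw [← star_dotProduct, star_mulVec, hP.eq, dotProduct_mulVec]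
    rw [this]; simp
  simp [quadForm, mulVec_sub, mulVec_smul, sub_dotProduct, dotProduct_sub, h]
  ring

lemma quadForm_eq_sum_eigenvalues {M : Matrix (Fin d) (Fin d) ℂ} (hM : M.IsHermitian)
    (x : Fin d → ℂ) :
    quadForm M x = ∑ i, hM.eigenvalues i *
      ‖((star (hM.eigenvectorUnitary : Matrix (Fin d) (Fin d) ℂ)) *ᵥ x) i‖ ^ 2 := by
  set U := (hM.eigenvectorUnitary : Matrix (Fin d) (Fin d) ℂ)
  have h : M = (star U)ᴴ * diagonal (fun i => (hM.eigenvalues i : ℂ)) * star U := by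
    conv_lhs => rw [hM.spectral_theorem, Unitary.conjStarAlgAut_apply]
    simp [U, star_eq_conjTranspose, Function.comp_def]
  conv_lhs => rw [h, quadForm_mul_mul]
  simp only [quadForm, dotProduct, mulVec_diagonal, Complex.re_sum]
  refine Finset.sum_congr rfl fun i _ => ?_
  rw [mul_left_comm, Complex.re_ofReal_mul]
  rw [Pi.star_apply, RCLike.star_def, ← Complex.normSq_eq_conj_mul_self, Complex.ofReal_re,
    Complex.normSq_eq_norm_sq]

lemma quadForm_one_eq_sum_unitary (U : Matrix.unitaryGroup (Fin d) ℂ) (x : Fin d → ℂ) :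
    quadForm 1 x = ∑ i, ‖((star (U : Matrix (Fin d) (Fin d) ℂ)) *ᵥ x) i‖ ^ 2 := by
  rw [← quadForm_one, ← quadForm_mul_mul]
  congr 1
  simp [star_eq_conjTranspose]
  exact (Unitary.coe_mul_star_self U).symm

/-- A dimension count: some nonzero `g` lies in the span of the top eigenvectors of `L`, up to
index `i`, while `X g` lies in the span of the bottom eigenvectors of `R`, from index `i`. -/
lemma exists_quadForm_ge_and_le {L R : Matrix (Fin d) (Fin d) ℂ} (hL : L.IsHermitian)
    (hR : R.IsHermitian) (X : Matrix (Fin d) (Fin d) ℂ) (i : Fin d) :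
    ∃ g : Fin d → ℂ, g ≠ 0 ∧ hL.eigenvalues i * quadForm 1 g ≤ quadForm L g ∧
      quadForm R (X *ᵥ g) ≤ hR.eigenvalues i * quadForm 1 (X *ᵥ g) := by
  -- The enumeration through which `eigenvalues` reads the decreasing `eigenvalues₀`.
  let e : Fin d → Fin (Fintype.card (Fin d)) :=
    (Fintype.equivOfCardEq (Fintype.card_fin _)).symm
  let Ul := star (hL.eigenvectorUnitary : Matrix (Fin d) (Fin d) ℂ)
  let Ur := star (hR.eigenvectorUnitary : Matrix (Fin d) (Fin d) ℂ) * X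
  -- Each `j ≠ i` imposes one condition: past `i` it kills a coordinate of `g`, before `i` one of `X
  -- g`. These are d - 1 conditions on d unknowns.
  let T : (Fin d → ℂ) →ₗ[ℂ] ({j : Fin d // j ≠ i} → ℂ) :=
    LinearMap.pi fun j => LinearMap.proj j.1 ∘ₗ
      (if e i < e j.1 then Ul.mulVecLin else Ur.mulVecLin)
  have hT : LinearMap.ker T ≠ ⊥ := by
    apply LinearMap.ker_ne_bot_of_finrank_lt
    simp [Fintype.card_subtype_compl]
    exact i.pos
  obtain ⟨g, hgT, hg⟩ := (Submodule.ne_bot_iff _).1 hT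
  have hgj : ∀ j, j ≠ i → (if e i < e j then Ul.mulVecLin else Ur.mulVecLin) g j = 0 :=
    fun j hj => congrFun (LinearMap.mem_ker.1 hgT) ⟨j, hj⟩
  refine ⟨g, hg, ?_, ?_⟩
  · rw [quadForm_eq_sum_eigenvalues hL, quadForm_one_eq_sum_unitary hL.eigenvectorUnitary,
      Finset.mul_sum]
    refine Finset.sum_le_sum fun j _ => ?_
    by_cases hlt : e i < e j
    · have hji : j ≠ i := by rintro rfl; exact lt_irrefl _ hlt
      have := hgj j hji
      rw [if_pos hlt, mulVecLin_apply] at this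
      simp [Ul] at this
      simp [this]
    · exact mul_le_mul_of_nonneg_right (hL.eigenvalues₀_antitone (not_lt.1 hlt)) (by positivity)
  · rw [quadForm_eq_sum_eigenvalues hR, quadForm_one_eq_sum_unitary hR.eigenvectorUnitary,
      Finset.mul_sum]
    refine Finset.sum_le_sum fun j _ => ?_
    by_cases hle : e i ≤ e j
    · exact mul_le_mul_of_nonneg_right (hR.eigenvalues₀_antitone hle) (by positivity)
    · have hji : j ≠ i := by rintro rfl; exact hle le_rfl
      have := hgj j hji
      rw [if_neg (fun h => hle h.le), mulVecLin_apply] at this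
      simp only [Ur, ← mulVec_mulVec] at this
      simp [this]

/-- Weyl's monotonicity principle, converse direction: eigenvalue domination gives domination in
the Loewner order up to a unitary conjugation. -/
lemma exists_unitary_le_of_eigenvalues_le {L R : Matrix (Fin d) (Fin d) ℂ} (hL : L.IsHermitian)
    (hR : R.IsHermitian) (h : ∀ i, hL.eigenvalues i ≤ hR.eigenvalues i) :
    ∃ V ∈ Matrix.unitaryGroup (Fin d) ℂ, L ≤ V * R * star V := by
  let u := hL.eigenvectorUnitary
  let w := hR.eigenvectorUnitary
  -- This unitary carries the eigenbasis of `R` to that of `L`, which reduces the claim to diagonal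
  -- matrices.
  refine ⟨(u * star w : Matrix.unitaryGroup (Fin d) ℂ), (u * star w).2, ?_⟩
  rw [← Unitary.conjStarAlgAut_apply (S := ℂ), Unitary.conjStarAlgAut_mul_apply,
    hR.conjStarAlgAut_star_eigenvectorUnitary]
  conv_lhs => rw [hL.spectral_theorem]
  rw [Unitary.conjStarAlgAut_apply, Unitary.conjStarAlgAut_apply]
  refine star_right_conjugate_le_conjugate ?_ _
  rw [le_iff, diagonal_sub]
  refine PosSemidef.diagonal fun i => ?_
  simpa using h i

/-- Cauchy–Schwarz for ‖Xg‖² = ⟨g, X²g⟩, from the discriminant of t ↦ ‖tg - X²g‖². -/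
lemma quadForm_one_mulVec_sq_le {X : Matrix (Fin d) (Fin d) ℂ} (hX : X.IsHermitian)
    (g : Fin d → ℂ) :
    quadForm 1 (X *ᵥ g) ^ 2 ≤ quadForm 1 g * quadForm 1 (X *ᵥ (X *ᵥ g)) := by
  have h : ∀ t : ℝ, 0 ≤ quadForm 1 g * (t * t) + (-2 * quadForm 1 (X *ᵥ g)) * t +
      quadForm 1 (X *ᵥ (X *ᵥ g)) := fun t => by
    have h0 := quadForm_nonneg (d := d) (M := 1) zero_le_one ((t : ℂ) • g - X *ᵥ (X *ᵥ g))
    rw [quadForm_smul_sub isHermitian_one] at h0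
    have h1 : (star (X *ᵥ (X *ᵥ g)) ⬝ᵥ ((1 : Matrix (Fin d) (Fin d) ℂ) *ᵥ g)).re =
        quadForm 1 (X *ᵥ g) := by
      rw [star_mulVec, hX.eq, one_mulVec, ← dotProduct_mulVec, quadForm, one_mulVec]
    rw [h1] at h0
    linarith
  have := discrim_le_zero h
  rw [discrim] at this
  linarith

section Resolution

variable {ι : Type*} [Fintype ι] {P : ι → Matrix (Fin d) (Fin d) ℂ}

/-- Kadison's inequality for a sub-resolution of the identity. -/
lemma quadForm_one_sum_smul_mulVec_le (hP : ∀ i, 0 ≤ P i) (hP1 : ∑ i, P i ≤ 1) (a : ι → ℝ)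
    (h : Fin d → ℂ) :
    quadForm 1 ((∑ i, (a i : ℂ) • P i) *ᵥ h) ≤ ∑ i, a i ^ 2 * quadForm (P i) h := by
  set y := (∑ i, (a i : ℂ) • P i) *ᵥ h with hy
  -- A variance: on expansion the cross terms give -2‖y‖² and the last term is at most ‖y‖².
  have h0 : 0 ≤ ∑ i, quadForm (P i) ((a i : ℂ) • h - y) :=
    Finset.sum_nonneg fun i _ => quadForm_nonneg (hP i) _
  have hH : ∀ i, (P i).IsHermitian := fun i => (nonneg_iff_posSemidef.1 (hP i)).1
  simp_rw [fun i => quadForm_smul_sub (hH i) (a i) h y] at h0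
  rw [Finset.sum_add_distrib, Finset.sum_sub_distrib, ← Finset.mul_sum] at h0
  have h1 : ∑ i, a i * (star y ⬝ᵥ (P i *ᵥ h)).re = quadForm 1 y := by
    rw [quadForm, one_mulVec]
    have h3 : star y ⬝ᵥ y = star y ⬝ᵥ ((∑ i, (a i : ℂ) • P i) *ᵥ h) := by rw [← hy]
    rw [h3]
    simp only [sum_mulVec, dotProduct_sum, smul_mulVec, dotProduct_smul, smul_eq_mul,
      Complex.re_sum, Complex.re_ofReal_mul]
  have h2 : ∑ i, quadForm (P i) y ≤ quadForm 1 y := by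
    have := quadForm_sum_smul Finset.univ (fun _ => (1 : ℝ)) P y
    simp only [Complex.ofReal_one, one_smul, one_mul] at this
    rw [← this]
    exact quadForm_mono hP1 y
  linarith

end Resolution

/-- Chebyshev's sum inequality with weights. -/
lemma sum_mul_sum_le_of_monovary {ι : Type*} [Fintype ι] {u b p : ι → ℝ} (hp : ∀ i, 0 ≤ p i)
    (hub : Monovary u b) :
    (∑ i, u i * p i) * ∑ i, b i * p i ≤ (∑ i, u i * b i * p i) * ∑ i, p i := by
  have h : 0 ≤ ∑ i, ∑ j, p i * p j * ((u j - u i) * (b j - b i)) :=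
    Finset.sum_nonneg fun i _ => Finset.sum_nonneg fun j _ =>
      mul_nonneg (mul_nonneg (hp i) (hp j)) (monovary_iff_forall_mul_nonneg.1 hub i j)
  have e1 : ∑ i, ∑ j, p i * p j * ((u j - u i) * (b j - b i)) =
      2 * ((∑ i, u i * b i * p i) * ∑ i, p i) - 2 * ((∑ i, u i * p i) * ∑ i, b i * p i) := by
    have c1 := Finset.sum_mul_sum Finset.univ Finset.univ (fun i => u i * b i * p i) p
    have c2 := Finset.sum_mul_sum Finset.univ Finset.univ p (fun i => u i * b i * p i)
    have c3 := Finset.sum_mul_sum Finset.univ Finset.univ (fun i => u i * p i) (fun i => b i * p i)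
    have c4 := Finset.sum_mul_sum Finset.univ Finset.univ (fun i => b i * p i) (fun i => u i * p i)
    rw [two_mul, two_mul]
    nth_rw 2 [mul_comm (∑ i, u i * b i * p i)]
    nth_rw 2 [mul_comm (∑ i, u i * p i)]
    rw [c1, c2, c3, c4]
    simp only [← Finset.sum_add_distrib, ← Finset.sum_sub_distrib]
    exact Finset.sum_congr rfl fun i _ => Finset.sum_congr rfl fun j _ => by ring
  linarith

lemma exists_unitary_le_of_monovary {ι : Type*} [Fintype ι] {P : ι → Matrix (Fin d) (Fin d) ℂ}
    (hP : ∀ i, 0 ≤ P i) (hP1 : ∑ i, P i ≤ 1) {a b : ι → ℝ} (ha : ∀ i, 0 ≤ a i) (hb : ∀ i, 0 ≤ b i)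
    (hab : Monovary a b) :
    ∃ V ∈ Matrix.unitaryGroup (Fin d) ℂ,
      (∑ i, (a i : ℂ) • P i) * (∑ i, (b i : ℂ) • P i) * (∑ i, (a i : ℂ) • P i) ≤
        V * (∑ i, ((a i ^ 2 * b i : ℝ) : ℂ) • P i) * star V := by
  have hpos : ∀ c : ι → ℝ, (∀ i, 0 ≤ c i) → (∑ i, (c i : ℂ) • P i).PosSemidef := fun c hc =>
    posSemidef_sum _ fun i _ => (nonneg_iff_posSemidef.1 (hP i)).smul
      (Complex.zero_le_real.2 (hc i))
  set X := ∑ i, (a i : ℂ) • P i with hXdef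
  set Y := ∑ i, (b i : ℂ) • P i with hYdef
  set R := ∑ i, ((a i ^ 2 * b i : ℝ) : ℂ) • P i with hRdef
  have hX : X.PosSemidef := hpos a ha
  have hY : Y.PosSemidef := hpos b hb
  have hR : R.PosSemidef := hpos _ fun i => mul_nonneg (sq_nonneg _) (hb i)
  have hXYX : X * Y * X = Xᴴ * Y * X := by rw [hX.1.eq]
  have hL : (X * Y * X).IsHermitian := by
    rw [hXYX]; exact (hY.conjTranspose_mul_mul_same X).1
  refine exists_unitary_le_of_eigenvalues_le hL hR.1 fun i => ?_
  obtain ⟨g, hg, hgL, hgR⟩ := exists_quadForm_ge_and_le hL hR.1 X i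
  set h := X *ᵥ g with hh
  -- Positivity of the eigenvalue is what forces `h ≠ 0`, so that ‖h‖⁴ can be cancelled at the end.
  rcases le_or_gt (hL.eigenvalues i) 0 with hμ | hμ
  · exact hμ.trans (hR.eigenvalues_nonneg i)
  set μ := hL.eigenvalues i
  have hgL' : μ * quadForm 1 g ≤ quadForm Y h := by
    refine hgL.trans_eq ?_
    rw [hXYX, quadForm_mul_mul]
  have hgpos := quadForm_one_pos hg
  have hh0 : h ≠ 0 := by
    intro h0
    rw [h0] at hgL'
    simp only [quadForm, mulVec_zero, dotProduct_zero, Complex.zero_re] at hgL' hgpos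
    exact absurd hgL' (not_le.2 (mul_pos hμ hgpos))
  have hhpos := quadForm_one_pos hh0
  have hCS : quadForm 1 h ^ 2 ≤ quadForm 1 g * quadForm 1 (X *ᵥ h) :=
    quadForm_one_mulVec_sq_le hX.1 g
  have hK : quadForm 1 (X *ᵥ h) ≤ ∑ i, a i ^ 2 * quadForm (P i) h :=
    quadForm_one_sum_smul_mulVec_le hP hP1 a h
  have hp : ∀ i, 0 ≤ quadForm (P i) h := fun i => quadForm_nonneg (hP i) h
  have hCh : (∑ i, a i ^ 2 * quadForm (P i) h) * quadForm Y h ≤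
      quadForm R h * ∑ i, quadForm (P i) h := by
    rw [hYdef, hRdef, quadForm_sum_smul, quadForm_sum_smul]
    refine sum_mul_sum_le_of_monovary hp fun i j hij => ?_
    exact pow_le_pow_left₀ (ha i) (hab hij) 2
  have hp1 : ∑ i, quadForm (P i) h ≤ quadForm 1 h := by
    have := quadForm_sum_smul Finset.univ (fun _ => (1 : ℝ)) P h
    simp only [Complex.ofReal_one, one_smul, one_mul] at this
    rw [← this]
    exact quadForm_mono hP1 h
  have hX0 : 0 ≤ quadForm 1 (X *ᵥ h) := quadForm_nonneg zero_le_one _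
  have hY0 : 0 ≤ quadForm Y h := quadForm_nonneg (nonneg_iff_posSemidef.2 hY) _
  have hR0 : 0 ≤ quadForm R h := quadForm_nonneg (nonneg_iff_posSemidef.2 hR) _
  have key : μ * quadForm 1 h ^ 2 ≤ hR.1.eigenvalues i * quadForm 1 h ^ 2 := calc
    μ * quadForm 1 h ^ 2 ≤ μ * (quadForm 1 g * quadForm 1 (X *ᵥ h)) :=
      mul_le_mul_of_nonneg_left hCS hμ.le
    _ = (μ * quadForm 1 g) * quadForm 1 (X *ᵥ h) := by ring
    _ ≤ quadForm Y h * ∑ i, a i ^ 2 * quadForm (P i) h :=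
      mul_le_mul hgL' hK hX0 hY0
    _ ≤ quadForm R h * ∑ i, quadForm (P i) h := by rw [mul_comm]; exact hCh
    _ ≤ (hR.1.eigenvalues i * quadForm 1 h) * quadForm 1 h :=
      mul_le_mul hgR hp1 (Finset.sum_nonneg fun i _ => hp i) (hR0.trans hgR)
    _ = hR.1.eigenvalues i * quadForm 1 h ^ 2 := by ring
  exact le_of_mul_le_mul_right key (pow_pos hhpos 2)

end QuadForm

theorem corollary2 (n d : ℕ) (A B : Matrix (Fin n) (Fin n) ℂ) (hAB : IsMonotonePair A B)
    (Φ : Matrix (Fin n) (Fin n) ℂ →ₚ[ℂ] Matrix (Fin d) (Fin d) ℂ) (hΦ : IsSubUnital Φ) :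
    ∃ V ∈ Matrix.unitaryGroup (Fin d) ℂ,
      Φ A * Φ B * Φ A ≤ V * Φ (A * B * A) * star V := by
  obtain ⟨C, f, g, hC, hf, hfm, hg, hgm, rfl, rfl⟩ := hAB
  let l := hC.1.eigenvalues
  let α := Unitary.conjStarAlgAut ℂ (Matrix (Fin n) (Fin n) ℂ) hC.1.eigenvectorUnitary
  let E : Fin n → Matrix (Fin n) (Fin n) ℂ := fun i => α (Matrix.single i i 1)
  have hdiag : ∀ c : Fin n → ℝ,
      Φ (α (Matrix.diagonal fun i => (c i : ℂ))) = ∑ i, (c i : ℂ) • Φ (E i) := fun c => by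
    have : (Matrix.diagonal fun i => (c i : ℂ)) = ∑ i, (c i : ℂ) • Matrix.single i i (1 : ℂ) := by
      simp [Matrix.smul_single, Matrix.sum_single_eq_diagonal]
    rw [this]
    simp only [E, map_sum, map_smul]
  have hcfc : ∀ f : ℝ → ℝ, cfc f C = α (Matrix.diagonal fun i => (f (l i) : ℂ)) := fun f =>
    hC.1.cfc_eq f
  have hE : ∀ i, 0 ≤ Φ (E i) := fun i => by
    refine map_nonneg Φ ?_
    have h0 : (0 : Matrix (Fin n) (Fin n) ℂ) ≤ Matrix.single i i 1 := by
      rw [← Matrix.diagonal_single, Matrix.nonneg_iff_posSemidef]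
      exact Matrix.PosSemidef.diagonal (Pi.single_nonneg.2 zero_le_one)
    simp only [E, α, Unitary.conjStarAlgAut_apply]
    exact star_right_conjugate_nonneg h0 _
  have hE1 : ∑ i, Φ (E i) ≤ 1 := by
    have h1 := hdiag 1
    simp only [Pi.one_apply, Complex.ofReal_one, one_smul, Matrix.diagonal_one, map_one] at h1
    rw [← h1]
    exact hΦ
  have hl : ∀ i, 0 ≤ l i := hC.eigenvalues_nonneg
  have hmono : Monovary (f ∘ l) (g ∘ l) := fun i j hij => by
    -- A strict increase of `g` rules out `l j < l i`, even where `g` has plateaus.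
    have hij' : l i ≤ l j := by
      by_contra hlt
      exact absurd hij (not_lt.2 (hgm (hl j) (hl i) (not_le.1 hlt).le))
    exact hfm (hl i) (hl j) hij'
  obtain ⟨V, hV, hle⟩ := exists_unitary_le_of_monovary hE hE1 (fun i => hf _ (hl i))
    (fun i => hg _ (hl i)) hmono
  refine ⟨V, hV, ?_⟩
  have hABA : cfc f C * cfc g C * cfc f C =
      α (Matrix.diagonal fun i => ((f (l i) ^ 2 * g (l i) : ℝ) : ℂ)) := by
    rw [hcfc f, hcfc g, ← map_mul, ← map_mul, Matrix.diagonal_mul_diagonal,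
      Matrix.diagonal_mul_diagonal]
    congr 2
    ext i
    push_cast
    ring
  rw [hABA, hcfc f, hcfc g, hdiag, hdiag, hdiag]
  exact hle
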